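/- For graphs $H_0,\dots,H_r$, let $R(H_0,\dots,H_r)$ be the smallest $N$ such that, for every colouring of the edges of the complete graph $K_N$ with the colours $0,\dots,r$, there is a colour $i$ for which the edges of colour $i$ contain a copy of $H_i$. Let $C_m$ denote the cycle on $m$ vertices. Let $r\ge 1$ and let $\ell_1,\dots,\ell_r$ be odd integers with $\ell_s>2^s$ for each $1\le s\le r$. Then there is an $n_0=n_0(r,\ell_1,\dots,\ell_r)$ such that, for every $n\ge n_0$, $$R(C_n,C_{\ell_1},\dots,C_{\ell_r})=2^r(n-1)+1.$$ -/

import Mathlib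

/-- Every colouring of the edges of the complete graph on `N` vertices with colours in `ι`
has, for some colour `i`, a (not necessarily induced) copy of `H i` in colour `i`. -/
def HasRamseyProperty {ι : Type*} {V : ι → Type*} (H : ∀ i, SimpleGraph (V i)) (N : ℕ) : Prop :=
  ∀ c : SimpleGraph.TopEdgeLabeling (Fin N) ι, ∃ i, (H i).IsContained (c.labelGraph i)

/-- `R` is the Ramsey number of the family `H`: the smallest `N` such that every colouring of
the edges of the complete graph on `N` vertices has, for some `i`, a copy of `H i` in colour `i`. -/
def IsRamseyNumber {ι : Type*} {V : ι → Type*} (H : ∀ i, SimpleGraph (V i)) (R : ℕ) : Prop :=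
  IsLeast {N : ℕ | HasRamseyProperty H N} R

/-! Lower bound: take `2 ^ r` blocks of `n - 1` vertices, colour `0` inside blocks, and between
blocks a colour naming a binary digit in which the block indices differ. Components of colour `0`
are too small for the long cycle, and every other colour is bipartite.

Upper bound: let `G` be the graph of colour `0` and `k = 2 ^ r`. By
`cycleGraph_isContained_or_hasMultipartiteHole`, `G` contains the long cycle or its complement
contains a complete multipartite graph with parts `1, t, …, t`. Indeed, without such a hole the
independence number is bounded, so `G` splits, up to boundedly many lost vertices, into separated
well-connected pieces. A well-connected set of at least `n` vertices is Hamiltonian by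
Chvátal–Erdős, and Ramsey's theorem shortens the cycle to length exactly `n`; so every piece has
fewer than `n` vertices. Counting then leaves exactly `k` large pieces, and each vertex is adjacent
to almost all of one of them, since otherwise it would complete a hole. The vertices thus fall into
`k` classes, each well connected, and one of them has at least `n` vertices.

In a hole, pigeonhole makes all pairs of parts monochromatic, giving a colouring of the complete
graph on `2 ^ r + 1` vertices by the colours `1, …, r`. Going down from colour `r`, a bipartite
colour is discarded by passing to its larger side. Some colour `s` is then not bipartite on at most
`2 ^ s + 1 ≤ ℓ_s` vertices; its odd cycle blows up to length `ℓ_s`. -/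

/-! ### Cycles as lists, and surgery on them. -/

/-- A list of distinct vertices, consecutive ones adjacent, the last adjacent to the first. -/
def SimpleGraph.IsCyclicList {V : Type*} (G : SimpleGraph V) (l : List V) : Prop :=
  l.Nodup ∧ l.IsChain G.Adj ∧ ∀ x ∈ l.getLast?, ∀ y ∈ l.head?, G.Adj x y

theorem SimpleGraph.val_cases_of_cycleGraph_adj {n : ℕ} {u v : Fin n} (h : (SimpleGraph.cycleGraph n).Adj u v) :
    u.val + 1 = v ∨ v.val + 1 = u ∨ (u.val = 0 ∧ v.val + 1 = n) ∨ (v.val = 0 ∧ u.val + 1 = n) := by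
  have hu := u.2
  have hv := v.2
  have key : ∀ a b : Fin n, (a - b).val = 1 → b.val + 1 = a ∨ (a.val = 0 ∧ b.val + 1 = n) := by
    intro a b hab
    have ha := a.2
    have hb := b.2
    rw [Fin.sub_def] at hab
    simp only at hab
    rcases Nat.lt_or_ge (n - b.val + a.val) n with h | h
    · rw [Nat.mod_eq_of_lt h] at hab; omega
    · rw [Nat.mod_eq_sub_mod h, Nat.mod_eq_of_lt (by omega)] at hab; omega
  rcases SimpleGraph.cycleGraph_adj'.1 h with h | h
  · rcases key _ _ h with h | h <;> omega
  · rcases key _ _ h with h | h <;> omega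

namespace SimpleGraph.IsCyclicList

variable {V : Type*} {G : SimpleGraph V}

theorem isChain_reverse_of_symm {l : List V} (h : l.IsChain G.Adj) : l.reverse.IsChain G.Adj := by
  rw [List.isChain_reverse]
  exact h.imp fun _ _ hab => hab.symm

theorem append_comm {A B : List V} (h : G.IsCyclicList (A ++ B)) : G.IsCyclicList (B ++ A) := by
  obtain ⟨h1, h2, h3⟩ := h
  rcases eq_or_ne A [] with rfl | hA
  · simpa using ⟨h1, h2, h3⟩
  rcases eq_or_ne B [] with rfl | hB
  · simpa using ⟨by simpa using h1, by simpa using h2, by simpa using h3⟩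
  rw [List.isChain_append] at h2
  rw [List.getLast?_append_of_ne_nil _ hB, List.head?_append_of_ne_nil _ hA] at h3
  refine ⟨List.nodup_append_comm.1 h1, List.isChain_append.2 ⟨h2.2.1, h2.1, h3⟩, ?_⟩
  rw [List.getLast?_append_of_ne_nil _ hA, List.head?_append_of_ne_nil _ hB]
  exact h2.2.2

theorem insert {Q l : List V} (h : G.IsCyclicList l) (hQ : Q.IsChain G.Adj) (hQn : Q.Nodup)
    (hd : Q.Disjoint l) (hQ0 : Q ≠ []) (hl0 : l ≠ [])
    (h1 : ∀ x ∈ l.getLast?, ∀ y ∈ Q.head?, G.Adj x y)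
    (h2 : ∀ x ∈ Q.getLast?, ∀ y ∈ l.head?, G.Adj x y) : G.IsCyclicList (Q ++ l) := by
  refine ⟨List.nodup_append'.2 ⟨hQn, h.1, hd⟩, List.isChain_append.2 ⟨hQ, h.2.1, h2⟩, ?_⟩
  rw [List.getLast?_append_of_ne_nil _ hl0, List.head?_append_of_ne_nil _ hQ0]
  exact h1

/-- The Chvátal–Erdős exchange: the two edges joining `A` and `B` are given up, the chord between
the two heads reconnects them with `A` reversed, and `Q` bridges the two last vertices. -/
theorem reroute {Q A B : List V} (h : G.IsCyclicList (A ++ B)) (hQ : Q.IsChain G.Adj)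
    (hQn : Q.Nodup) (hd : Q.Disjoint (A ++ B)) (hQ0 : Q ≠ []) (hA : A ≠ []) (hB : B ≠ [])
    (h1 : ∀ x ∈ B.getLast?, ∀ y ∈ Q.head?, G.Adj x y)
    (h2 : ∀ x ∈ Q.getLast?, ∀ y ∈ A.getLast?, G.Adj x y)
    (h3 : ∀ x ∈ A.head?, ∀ y ∈ B.head?, G.Adj x y) :
    G.IsCyclicList (Q ++ (A.reverse ++ B)) := by
  obtain ⟨g1, g2, -⟩ := h
  rw [List.isChain_append] at g2
  have hA' : A.reverse ≠ [] := by simpa using hA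
  have hAB : A.reverse ++ B ≠ [] := by simp [hA]
  refine ⟨?_, ?_, ?_⟩
  · rw [List.nodup_append'] at g1 ⊢
    refine ⟨hQn, ?_, by grind [List.Disjoint]⟩
    rw [List.nodup_append']
    exact ⟨by simpa using g1.1, g1.2.1, by grind [List.Disjoint]⟩
  · refine List.isChain_append.2 ⟨hQ, List.isChain_append.2
      ⟨isChain_reverse_of_symm g2.1, g2.2.1, ?_⟩, ?_⟩
    · simpa using h3
    · rw [List.head?_append_of_ne_nil _ hA']
      simpa using h2
  · rw [List.getLast?_append_of_ne_nil _ hAB, List.getLast?_append_of_ne_nil _ hB,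
      List.head?_append_of_ne_nil _ hQ0]
    exact h1

/-- Deleting `x` and the edges from `A` to `B` and from `B` to `C` leaves three paths, which three
chords join into a cycle that has lost only `x`. -/
theorem drop_vertex {x : V} {A B C : List V} (h : G.IsCyclicList (x :: (A ++ (B ++ C))))
    (hA : A ≠ []) (hB : B ≠ []) (hC : C ≠ [])
    (h0 : ∀ x ∈ C.getLast?, ∀ y ∈ B.getLast?, G.Adj x y)
    (h1 : ∀ x ∈ A.getLast?, ∀ y ∈ C.head?, G.Adj x y)
    (h2 : ∀ x ∈ B.head?, ∀ y ∈ A.head?, G.Adj x y) :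
    G.IsCyclicList (A ++ (C ++ B.reverse)) := by
  obtain ⟨g1, g2, -⟩ := h
  replace g1 := g1.tail
  replace g2 := g2.tail
  simp only [List.tail_cons, List.isChain_append, List.nodup_append'] at g1 g2
  have hCB : C ++ B.reverse ≠ [] := by simp [hC]
  refine ⟨?_, ?_, ?_⟩
  · rw [List.nodup_append', List.nodup_append']
    grind [List.Disjoint, List.nodup_reverse]
  · refine List.isChain_append.2 ⟨g2.1, List.isChain_append.2
      ⟨g2.2.1.2.1, isChain_reverse_of_symm g2.2.1.1, ?_⟩, ?_⟩
    · simpa using h0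
    · rwa [List.head?_append_of_ne_nil _ hC]
  · rw [List.getLast?_append_of_ne_nil _ hCB, List.getLast?_append_of_ne_nil _ (by simpa using hB),
      List.head?_append_of_ne_nil _ hA]
    simpa using h2

theorem cycleGraph_isContained {l : List V} (h : G.IsCyclicList l) (hl : 2 < l.length) :
    (cycleGraph l.length).IsContained G := by
  obtain ⟨h1, h2, h3⟩ := h
  have hlast : G.Adj l[l.length - 1] l[0] := by
    apply h3 <;> grind [List.head?_eq_getElem?]
  refine ⟨⟨⟨fun i => l[i], ?_⟩, ?_⟩⟩
  · intro ⟨x, hx⟩ ⟨y, hy⟩ hab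
    rcases val_cases_of_cycleGraph_adj hab with h | h | ⟨h, h'⟩ | ⟨h, h'⟩ <;> simp only at h
    · subst h; exact h2.getElem x hy
    · subst h; exact (h2.getElem y hx).symm
    · obtain rfl : y = l.length - 1 := by simp only at h'; omega
      subst h; exact hlast.symm
    · obtain rfl : x = l.length - 1 := by simp only at h'; omega
      subst h; exact hlast
  · intro ⟨x, hx⟩ ⟨y, hy⟩ hab
    have := (h1.getElem_inj_iff).1 hab
    exact Fin.ext this

end SimpleGraph.IsCyclicList

theorem List.head?_take_drop {α : Type*} {l : List α} {i j : ℕ} (hij : i < j) (hj : j ≤ l.length) :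
    ((l.drop i).take (j - i)).head? = some l[i] := by
  rw [List.head?_eq_getElem?, List.getElem?_take_of_lt (by omega), List.getElem?_drop,
    Nat.add_zero, List.getElem?_eq_getElem]

theorem List.getLast?_take_drop {α : Type*} {l : List α} {i j : ℕ} (hij : i ≤ j)
    (hj : j < l.length) : ((l.drop i).take (j + 1 - i)).getLast? = some l[j] := by
  rw [List.getLast?_eq_getElem?, List.length_take, List.length_drop,
    show min (j + 1 - i) (l.length - i) - 1 = j - i by omega, List.getElem?_take_of_lt (by omega),
    List.getElem?_drop, show i + (j - i) = j by omega, List.getElem?_eq_getElem]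

theorem List.getLast?_take_succ {α : Type*} {l : List α} {i : ℕ} (hi : i < l.length) :
    (l.take (i + 1)).getLast? = some l[i] := by
  simpa using List.getLast?_take_drop (l := l) (Nat.zero_le i) hi

/-! ### Connectivity and Hamiltonian cycles. -/

namespace SimpleGraph

open Finset

variable {V : Type*} (G : SimpleGraph V)

open Classical in
/-- The vertices of `P` outside `H` that have a neighbour in `H`. -/
noncomputable def boundaryIn (P H : Finset V) : Finset V :=
  {x ∈ P \ H | ∃ h ∈ H, G.Adj h x}

open Classical in
/-- Every nonempty `H ⊆ P` has at least `m` outer neighbours in `P`, unless these together with `H`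
exhaust `P`: no set of fewer than `m` vertices separates the graph induced on `P`. -/
def ConnectedWithin (P : Finset V) (m : ℕ) : Prop :=
  ∀ H ⊆ P, H.Nonempty → m ≤ #(G.boundaryIn P H) ∨ H ∪ G.boundaryIn P H = P

variable {G}

theorem mem_boundaryIn {P H : Finset V} {x : V} :
    x ∈ G.boundaryIn P H ↔ (x ∈ P ∧ x ∉ H) ∧ ∃ h ∈ H, G.Adj h x := by
  simp [boundaryIn]

theorem Walk.forall_mem_support_of_forall_adj {p : V → Prop} (h : ∀ a b, G.Adj a b → p b)
    {u v : V} (w : G.Walk u v) (hu : p u) : ∀ z ∈ w.support, p z := by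
  induction w with
  | nil => simpa using hu
  | cons hab q ih =>
    intro z hz
    rcases List.mem_cons.1 (by simpa using hz) with rfl | hz
    · exact hu
    · exact ih (h _ _ hab) z hz

/-- The Chvátal–Erdős theorem. -/
theorem ConnectedWithin.exists_isCyclicList {P : Finset V} {m : ℕ} (hP : G.ConnectedWithin P m)
    (hind : ∀ I ⊆ P, G.IsIndepSet (I : Set V) → #I < m) (hm : m ≤ #P) :
    ∃ l, G.IsCyclicList l ∧ l.length = #P ∧ ∀ x, x ∈ l ↔ x ∈ P := by
  classical
  -- A single edge counts as a cyclic list of length 2, so the failure of independence of `P`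
  -- already supplies a member of `T`.
  let T : Set ℕ := List.length '' {l : List V | G.IsCyclicList l ∧ 2 ≤ l.length ∧ ∀ x ∈ l, x ∈ P}
  have hlen : ∀ l : List V, l.Nodup → (∀ x ∈ l, x ∈ P) → l.length ≤ #P := by
    intro l h1 h3
    rw [← List.toFinset_card_of_nodup h1]
    exact card_le_card (by intro x hx; exact h3 x (by simpa using hx))
  have hTne : T.Nonempty := by
    have : ¬ G.IsIndepSet (P : Set V) := fun h => absurd (hind P subset_rfl h) (by omega)
    simp only [isIndepSet_iff, Set.Pairwise, not_forall, not_not] at this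
    obtain ⟨a, ha, b, hb, hab, hadj⟩ := this
    refine ⟨2, [a, b], ⟨⟨by simpa using hab, by simpa using hadj, by simpa using hadj.symm⟩,
      by simp, ?_⟩, rfl⟩
    simpa using ⟨ha, hb⟩
  have hTbdd : BddAbove T := ⟨#P, by rintro _ ⟨l, ⟨h1, -, h3⟩, rfl⟩; exact hlen l h1.1 h3⟩
  obtain ⟨l, ⟨hl, hl2, hlP⟩, hlT⟩ := Nat.sSup_mem hTne hTbdd
  have hmax : ∀ l' : List V, G.IsCyclicList l' → (∀ x ∈ l', x ∈ P) → l'.length ≤ l.length := by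
    intro l' h1 h2
    by_contra hcon
    rw [hlT] at hcon
    exact hcon (le_csSup hTbdd ⟨l', ⟨h1, by omega, h2⟩, rfl⟩)
  clear_value T
  suffices h : ∀ x ∈ P, x ∈ l by
    refine ⟨l, hl, le_antisymm (hlen l hl.1 hlP) ?_, fun x => ⟨hlP x, h x⟩⟩
    rw [← List.toFinset_card_of_nodup hl.1]
    exact card_le_card (by intro x hx; simpa using h x hx)
  intro x hx
  by_contra hxl
  -- `H` will be the component of `x` in `P` off a longest cycle `l`; its boundary in `P` lies on
  -- `l`, and any two boundary vertices are joined by a path through vertices off `l`.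
  let G' : SimpleGraph V :=
    { Adj := fun a b => G.Adj a b ∧ (a ∈ P ∧ a ∉ l) ∧ (b ∈ P ∧ b ∉ l)
      symm := ⟨fun a b h => ⟨h.1.symm, h.2.2, h.2.1⟩⟩
      loopless := ⟨fun a h => G.loopless.irrefl a h.1⟩ }
  let H : Finset V := {y ∈ P | y ∉ l ∧ G'.Reachable x y}
  have hH : ∀ y, y ∈ H ↔ y ∈ P ∧ y ∉ l ∧ G'.Reachable x y := by simp [H]
  have hxH : x ∈ H := (hH x).2 ⟨hx, hxl, Reachable.refl _⟩
  have hbl : ∀ y ∈ G.boundaryIn P H, y ∈ l := by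
    intro y hy
    obtain ⟨⟨hyP, hyH⟩, h, hh, hadj⟩ := mem_boundaryIn.1 hy
    by_contra hyl
    obtain ⟨h1, h2, h3⟩ := (hH h).1 hh
    exact hyH ((hH y).2 ⟨hyP, hyl,
      h3.trans (Adj.reachable (G := G') ⟨hadj, ⟨h1, h2⟩, ⟨hyP, hyl⟩⟩)⟩)
  have hpath : ∀ u ∈ G.boundaryIn P H, ∀ w ∈ G.boundaryIn P H, ∃ Q : List V, Q ≠ [] ∧
      Q.IsChain G.Adj ∧ Q.Nodup ∧ (∀ z ∈ Q, z ∈ P ∧ z ∉ l) ∧ (∀ z ∈ Q.head?, G.Adj u z) ∧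
      (∀ z ∈ Q.getLast?, G.Adj z w) := by
    intro u hu w hw
    obtain ⟨-, a, ha, hua⟩ := mem_boundaryIn.1 hu
    obtain ⟨-, b, hb, hwb⟩ := mem_boundaryIn.1 hw
    obtain ⟨a1, a2, a3⟩ := (hH a).1 ha
    obtain ⟨-, -, b3⟩ := (hH b).1 hb
    obtain ⟨p⟩ := a3.symm.trans b3
    refine ⟨p.bypass.support, by simp, (p.bypass.isChain_adj_support).imp fun _ _ (h : G'.Adj _ _) => h.1,
      p.bypass_isPath.support_nodup,
      Walk.forall_mem_support_of_forall_adj (p := fun z => z ∈ P ∧ z ∉ l)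
        (fun _ _ (h : G'.Adj _ _) => h.2.2) _ ⟨a1, a2⟩, ?_, ?_⟩
    · rw [List.head?_eq_some_head (by simp)]
      simpa using hua.symm
    · rw [List.getLast?_eq_some_getLast (by simp)]
      simpa using hwb
  have hlpos : 0 < l.length := by omega
  let nx : ℕ → V := fun i => l[(i + 1) % l.length]'(Nat.mod_lt _ hlpos)
  -- Were two consecutive cycle vertices both in the boundary, a path off `l` could be inserted
  -- between them.
  have hsucc : ∀ i (hi : i < l.length), l[i] ∈ G.boundaryIn P H → nx i ∉ G.boundaryIn P H := by
    intro i hi hu hw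
    obtain ⟨Q, q0, q1, q2, q3, q4, q5⟩ := hpath _ hu _ hw
    have hl' : G.IsCyclicList (l.drop (i + 1) ++ l.take (i + 1)) :=
      IsCyclicList.append_comm (by simpa using hl)
    have hne : l.drop (i + 1) ++ l.take (i + 1) ≠ [] := by
      rw [← List.length_pos_iff_ne_nil]; simp; omega
    have hlast : (l.drop (i + 1) ++ l.take (i + 1)).getLast? = some l[i] := by
      rw [List.getLast?_append_of_ne_nil _ (by rw [← List.length_pos_iff_ne_nil]; simp; omega),
        List.getLast?_take_succ hi]
    have hhead : (l.drop (i + 1) ++ l.take (i + 1)).head? = some (nx i) := by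
      rcases Nat.lt_or_ge (i + 1) l.length with h | h
      · simp [nx, Nat.mod_eq_of_lt h, h]
      · have : i + 1 = l.length := by omega
        simp only [nx, this, Nat.mod_self, List.drop_length, List.take_length, List.nil_append]
        rw [List.head?_eq_getElem?, List.getElem?_eq_getElem]
    have := hmax _ (hl'.insert q1 q2 (by
      intro z hz hz'
      refine (q3 z hz).2 ?_
      rcases List.mem_append.1 hz' with h | h
      · exact List.mem_of_mem_drop h
      · exact List.mem_of_mem_take h) q0 hne (by rw [hlast]; simpa using q4)
      (by rw [hhead]; simpa using q5)) (by
        intro z hz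
        rcases List.mem_append.1 hz with h | h
        · exact (q3 z h).1
        · rcases List.mem_append.1 h with h | h
          · exact hlP z (List.mem_of_mem_drop h)
          · exact hlP z (List.mem_of_mem_take h))
    have hq := List.length_pos_iff_ne_nil.2 q0
    simp at this
    omega
  have hnxl : ∀ i, nx i ∈ l := fun i => List.getElem_mem _
  -- With at least `m` boundary vertices, their successors cannot be independent, and an edge
  -- between two successors allows a longer cycle. If instead `H` and its boundary exhaust `P`, all
  -- of `l` is boundary, against `hsucc`.
  rcases hP H (filter_subset _ _) ⟨x, hxH⟩ with hbig | hall
  · let I : Finset ℕ := {i ∈ range l.length | ∃ h : i < l.length, l[i] ∈ G.boundaryIn P H}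
    have hI : ∀ i, i ∈ I ↔ ∃ h : i < l.length, l[i] ∈ G.boundaryIn P H := by
      intro i; simp only [I, mem_filter, mem_range]; grind
    have hIcard : m ≤ #I := by
      refine hbig.trans ?_
      refine card_le_card_of_surjOn (fun i => l.getD i x) ?_
      intro y hy
      obtain ⟨i, hi, rfl⟩ := List.getElem_of_mem (hbl y hy)
      exact ⟨i, (hI i).2 ⟨hi, hy⟩, by simp [hi]⟩
    have hinj : Set.InjOn nx I := by
      intro i hi j hj hij
      obtain ⟨hi, -⟩ := (hI i).1 hi
      obtain ⟨hj, -⟩ := (hI j).1 hj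
      have := (hl.1.getElem_inj_iff).1 hij
      rcases Nat.lt_or_ge (i + 1) l.length with h | h <;>
        rcases Nat.lt_or_ge (j + 1) l.length with h' | h'
      · rw [Nat.mod_eq_of_lt h, Nat.mod_eq_of_lt h'] at this; omega
      · rw [Nat.mod_eq_of_lt h, show j + 1 = l.length by omega, Nat.mod_self] at this; omega
      · rw [Nat.mod_eq_of_lt h', show i + 1 = l.length by omega, Nat.mod_self] at this; omega
      · omega
    have hnind : ¬ G.IsIndepSet (I.image nx : Set V) := by
      intro h
      have h1 := hind (I.image nx) (by
        intro z hz
        obtain ⟨i, -, rfl⟩ := mem_image.1 hz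
        exact hlP _ (hnxl i)) h
      rw [card_image_of_injOn hinj] at h1
      omega
    have : ∃ i ∈ I, ∃ j ∈ I, i < j ∧ G.Adj (nx i) (nx j) := by
      simp only [isIndepSet_iff, Set.Pairwise, not_forall, not_not] at hnind
      obtain ⟨a, ha, b, hb, hab, hadj⟩ := hnind
      obtain ⟨i, hi, rfl⟩ := mem_image.1 (mem_coe.1 ha)
      obtain ⟨j, hj, rfl⟩ := mem_image.1 (mem_coe.1 hb)
      rcases lt_trichotomy i j with h | h | h
      · exact ⟨i, hi, j, hj, h, hadj⟩
      · exact absurd (by rw [h]) hab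
      · exact ⟨j, hj, i, hi, h, hadj.symm⟩
    obtain ⟨i, hi, j, hj, hij, hadj⟩ := this
    obtain ⟨hil, hi⟩ := (hI i).1 hi
    obtain ⟨hjl, hj⟩ := (hI j).1 hj
    obtain ⟨Q, q0, q1, q2, q3, q4, q5⟩ := hpath _ hi _ hj
    -- Read from `nx i`, the cycle is `Y` followed by `Z ++ X`: `Y` ends at `l[j]`, and `Z ++ X`
    -- runs from `nx j` to `l[i]`. Here `Z` may be empty.
    let X := l.take (i + 1)
    let Y := (l.drop (i + 1)).take (j + 1 - (i + 1))
    let Z := l.drop (j + 1)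
    have hXYZ : l = X ++ (Y ++ Z) := by
      have h1 : Z = (l.drop (i + 1)).drop (j + 1 - (i + 1)) := by
        simp only [Z, List.drop_drop]; congr 1; omega
      rw [h1, List.take_append_drop, List.take_append_drop]
    have hX : X ≠ [] := by rw [← List.length_pos_iff_ne_nil]; simp [X]; omega
    have hY : Y ≠ [] := by rw [← List.length_pos_iff_ne_nil]; simp [Y]; omega
    have hXlast : X.getLast? = some l[i] := List.getLast?_take_succ hil
    have hYlast : Y.getLast? = some l[j] := List.getLast?_take_drop (by omega) hjl
    have hYhead : Y.head? = some (nx i) := by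
      simp only [Y, nx]
      rw [List.head?_take_drop (by omega) (by omega)]
      simp [Nat.mod_eq_of_lt (show i + 1 < l.length by omega)]
    have hZXhead : (Z ++ X).head? = some (nx j) := by
      rcases Nat.lt_or_ge (j + 1) l.length with h | h
      · simp [Z, nx, Nat.mod_eq_of_lt h, h]
      · have : j + 1 = l.length := by omega
        simp only [Z, X, nx, this, Nat.mod_self, List.drop_length, List.nil_append]
        rw [List.head?_eq_getElem?, List.getElem?_take_of_lt (by omega),
          List.getElem?_eq_getElem]
    have hcyc : G.IsCyclicList (Y ++ (Z ++ X)) := by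
      rw [← List.append_assoc]
      exact IsCyclicList.append_comm (hXYZ ▸ hl)
    have hmem : ∀ z, z ∈ Y ++ (Z ++ X) ↔ z ∈ l := by
      intro z; conv_rhs => rw [hXYZ]
      simp only [List.mem_append]; tauto
    have := hmax _ (hcyc.reroute q1 q2 (fun z hz hz' => (q3 z hz).2 ((hmem z).1 hz')) q0 hY
      (by simp [hX]) (by
        rw [List.getLast?_append_of_ne_nil _ hX, hXlast]; simpa using q4)
      (by rw [hYlast]; simpa using q5) (by rw [hYhead, hZXhead]; simpa using hadj)) (by
        intro z hz
        rcases List.mem_append.1 hz with h | h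
        · exact (q3 z h).1
        · refine hlP z ((hmem z).1 ?_)
          simpa using h)
    have hq := List.length_pos_iff_ne_nil.2 q0
    have hlen : l.length = X.length + (Y.length + Z.length) := by
      conv_lhs => rw [hXYZ]
      simp
    simp only [List.length_append, List.length_reverse] at this
    omega
  · have h : ∀ y ∈ l, y ∈ G.boundaryIn P H := by
      intro y hy
      have := hlP y hy
      rw [← hall, mem_union] at this
      exact this.resolve_left fun h => ((hH y).1 h).2.1 hy
    exact hsucc 0 hlpos (h _ (List.getElem_mem _)) (h _ (hnxl 0))

end SimpleGraph

/-! ### Ramsey's theorem and shortening cycles. -/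

namespace SimpleGraph

open Finset

universe u

/-- Ramsey's theorem for graphs. -/
theorem exists_indepSet_or_clique (a b : ℕ) : ∃ R : ℕ, ∀ (V : Type u) (G : SimpleGraph V)
    (S : Finset V), R ≤ #S → (∃ T ⊆ S, #T = a ∧ G.IsIndepSet (T : Set V)) ∨
      (∃ T ⊆ S, #T = b ∧ G.IsClique (T : Set V)) := by
  classical
  induction h : a + b generalizing a b with
  | zero =>
    obtain rfl : a = 0 := by omega
    exact ⟨0, fun V G S _ => .inl ⟨∅, by simp⟩⟩
  | succ n ih =>
    rcases a with _ | a
    · exact ⟨0, fun V G S _ => .inl ⟨∅, by simp⟩⟩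
    rcases b with _ | b
    · exact ⟨0, fun V G S _ => .inr ⟨∅, by simp⟩⟩
    obtain ⟨R₁, h₁⟩ := ih a (b + 1) (by omega)
    obtain ⟨R₂, h₂⟩ := ih (a + 1) b (by omega)
    refine ⟨R₁ + R₂ + 1, fun V G S hS => ?_⟩
    obtain ⟨v, hv⟩ : S.Nonempty := card_pos.1 (by omega)
    have hcard := card_filter_add_card_filter_not (s := S.erase v) (fun x => G.Adj v x)
    rw [card_erase_of_mem hv] at hcard
    have key : ∀ T ⊆ S.erase v, insert v T ⊆ S ∧ #(insert v T) = #T + 1 := fun T hT =>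
      ⟨insert_subset hv fun x hx => mem_of_mem_erase (hT hx),
        card_insert_of_notMem fun hx => notMem_erase v S (hT hx)⟩
    rcases Nat.lt_or_ge #{x ∈ S.erase v | G.Adj v x} R₂ with hlt | hge
    · rcases h₁ V G {x ∈ S.erase v | ¬ G.Adj v x} (by omega) with ⟨T, hT, hc, hi⟩ | ⟨T, hT, hc, hi⟩
      · obtain ⟨k1, k2⟩ := key T (hT.trans (filter_subset _ _))
        have k3 := fun x (hx : x ∈ T) => (mem_filter.1 (hT hx)).2
        refine .inl ⟨insert v T, k1, by omega, ?_⟩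
        rw [coe_insert, isIndepSet_iff]
        refine hi.insert fun x hx _ => ⟨k3 x hx, fun h => k3 x hx h.symm⟩
      · refine .inr ⟨T, fun x hx => mem_of_mem_erase (mem_filter.1 (hT hx)).1, hc, hi⟩
    · rcases h₂ V G _ hge with ⟨T, hT, hc, hi⟩ | ⟨T, hT, hc, hi⟩
      · refine .inl ⟨T, fun x hx => mem_of_mem_erase (mem_filter.1 (hT hx)).1, hc, hi⟩
      · obtain ⟨k1, k2⟩ := key T (hT.trans (filter_subset _ _))
        have k3 := fun x (hx : x ∈ T) => (mem_filter.1 (hT hx)).2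
        refine .inr ⟨insert v T, k1, by omega, ?_⟩
        rw [coe_insert, isClique_iff]
        exact hi.insert fun x hx _ => k3 x hx

/-- Ramsey's theorem is applied to indices rather than vertices, so that the resulting index set can
be refined again for another sequence `f`. -/
theorem exists_pairwise_adj_comp (m b : ℕ) : ∃ R : ℕ, ∀ (V : Type u) (G : SimpleGraph V)
    (P : Finset V), (∀ I ⊆ P, G.IsIndepSet (I : Set V) → #I < m) →
    ∀ (f : ℕ → V) (S : Finset ℕ), Set.InjOn f S → (∀ i ∈ S, f i ∈ P) → R ≤ #S →
      ∃ T ⊆ S, #T = b ∧ ∀ i ∈ T, ∀ j ∈ T, i ≠ j → G.Adj (f i) (f j) := by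
  classical
  obtain ⟨R, hR⟩ := exists_indepSet_or_clique.{0} m b
  refine ⟨R, fun V G P hP f S hf hfP hS => ?_⟩
  rcases hR ℕ (G.comap f) S hS with ⟨T, hT, hc, hi⟩ | ⟨T, hT, hc, hi⟩
  · have := hP (T.image f) (by
      intro x hx
      obtain ⟨i, hi, rfl⟩ := mem_image.1 hx
      exact hfP i (hT hi)) (by
      rintro _ hx _ hy hxy
      obtain ⟨i, h1, rfl⟩ := mem_image.1 (mem_coe.1 hx)
      obtain ⟨j, h2, rfl⟩ := mem_image.1 (mem_coe.1 hy)
      exact hi h1 h2 fun h => hxy (by rw [h]))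
    rw [card_image_of_injOn (hf.mono (by exact_mod_cast hT))] at this
    omega
  · exact ⟨T, hT, hc, fun i h1 j h2 hij => hi h1 h2 hij⟩

/-- In a graph with bounded independence number a long cycle can be shortened by one vertex. -/
theorem exists_isCyclicList_pred (m : ℕ) : ∃ L : ℕ, ∀ (V : Type u) (G : SimpleGraph V)
    (P : Finset V), (∀ I ⊆ P, G.IsIndepSet (I : Set V) → #I < m) →
    ∀ l : List V, G.IsCyclicList l → (∀ x ∈ l, x ∈ P) → L ≤ l.length →
      ∃ l', G.IsCyclicList l' ∧ (∀ x ∈ l', x ∈ P) ∧ l'.length + 1 = l.length := by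
  obtain ⟨R₂, h₂⟩ := exists_pairwise_adj_comp.{u} m 3
  obtain ⟨R₁, h₁⟩ := exists_pairwise_adj_comp.{u} m R₂
  obtain ⟨R₀, h₀⟩ := exists_pairwise_adj_comp.{u} m R₁
  refine ⟨3 * R₀ + 1, fun V G P hind l hl hlP hL => ?_⟩
  have hpos : 0 < l.length := by omega
  -- The cycle is cut into consecutive triples, `e` being the place within a triple. The default
  -- value is never reached for indices below `R₀`.
  let f : ℕ → ℕ → V := fun e i => l.getD (3 * i + e) l[0]
  have hf : ∀ e i (h : 3 * i + e < l.length), f e i = l[3 * i + e] := by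
    intro e i h
    simp [f, h]
  have hinj : ∀ e < 3, ∀ S ⊆ range R₀, Set.InjOn (f e) S := by
    intro e he S hS i hi j hj hij
    have hi := mem_range.1 (hS hi)
    have hj := mem_range.1 (hS hj)
    rw [hf e i (by omega), hf e j (by omega), hl.1.getElem_inj_iff] at hij
    omega
  have hmem : ∀ e < 3, ∀ S ⊆ range R₀, ∀ i ∈ S, f e i ∈ P := by
    intro e he S hS i hi
    have hi := mem_range.1 (hS hi)
    rw [hf e i (by omega)]
    exact hlP _ (List.getElem_mem _)
  -- Three nested refinements give three triples such that, at each of the three places, their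
  -- vertices are pairwise adjacent.
  obtain ⟨T₀, s₀, c₀, a₀⟩ := h₀ V G P hind (f 0) (range R₀) (hinj 0 (by omega) _ subset_rfl)
    (hmem 0 (by omega) _ subset_rfl) (by simp)
  obtain ⟨T₁, s₁, c₁, a₁⟩ := h₁ V G P hind (f 1) T₀ (hinj 1 (by omega) _ s₀)
    (hmem 1 (by omega) _ s₀) c₀.ge
  obtain ⟨T₂, s₂, c₂, a₂⟩ := h₂ V G P hind (f 2) T₁ (hinj 2 (by omega) _ (s₁.trans s₀))
    (hmem 2 (by omega) _ (s₁.trans s₀)) c₁.ge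
  obtain ⟨p, hp, q, hq, s, hs, hpq, hqs⟩ : ∃ p ∈ T₂, ∃ q ∈ T₂, ∃ s ∈ T₂, p < q ∧ q < s :=
    ⟨T₂.orderEmbOfFin c₂ 0, orderEmbOfFin_mem _ _ _, T₂.orderEmbOfFin c₂ 1,
      orderEmbOfFin_mem _ _ _, T₂.orderEmbOfFin c₂ 2, orderEmbOfFin_mem _ _ _, by simp, by simp⟩
  have hsR : s < R₀ := mem_range.1 (s₀ (s₁ (s₂ hs)))
  have e0 := a₀ p (s₁ (s₂ hp)) s (s₁ (s₂ hs)) (by omega)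
  have e1 := a₁ q (s₂ hq) s (s₂ hs) (by omega)
  have e2 := a₂ p hp q hq (by omega)
  rw [hf 0 p (by omega), hf 0 s (by omega)] at e0
  rw [hf 1 q (by omega), hf 1 s (by omega)] at e1
  rw [hf 2 p (by omega), hf 2 q (by omega)] at e2
  -- The vertex dropped is `l[3 * p + 1]`. `A` covers positions `3p + 2` to `3q + 1`, `B` covers `3q
  -- + 2` to `3s`, and the third path runs from `3s + 1` around to `3p`; `e0`, `e1`, `e2` are
  -- exactly the required chords.
  let A := (l.drop (3 * p + 2)).take (3 * q + 1 + 1 - (3 * p + 2))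
  let B := (l.drop (3 * q + 2)).take (3 * s + 1 - (3 * q + 2))
  have hsplit : l.drop (3 * p + 1) = l[3 * p + 1] :: (A ++ (B ++ l.drop (3 * s + 1))) := by
    have hB : B ++ l.drop (3 * s + 1) = l.drop (3 * q + 2) := by
      rw [show l.drop (3 * s + 1) = (l.drop (3 * q + 2)).drop (3 * s + 1 - (3 * q + 2)) by
        rw [List.drop_drop]; congr 1; omega]
      exact List.take_append_drop _ _
    have hA : A ++ l.drop (3 * q + 2) = l.drop (3 * p + 2) := by
      rw [show l.drop (3 * q + 2) = (l.drop (3 * p + 2)).drop (3 * q + 1 + 1 - (3 * p + 2)) by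
        rw [List.drop_drop]; congr 1; omega]
      exact List.take_append_drop _ _
    rw [hB, hA, ← List.drop_eq_getElem_cons]
  have hcyc : G.IsCyclicList (l[3 * p + 1] ::
      (A ++ (B ++ (l.drop (3 * s + 1) ++ l.take (3 * p + 1))))) := by
    have : G.IsCyclicList (l.drop (3 * p + 1) ++ l.take (3 * p + 1)) :=
      IsCyclicList.append_comm (by simpa using hl)
    rw [hsplit] at this
    simpa using this
  have hA : A ≠ [] := by rw [← List.length_pos_iff_ne_nil]; simp [A]; omega
  have hB : B ≠ [] := by rw [← List.length_pos_iff_ne_nil]; simp [B]; omega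
  have hX : l.take (3 * p + 1) ≠ [] := by rw [← List.length_pos_iff_ne_nil]; simp; omega
  have hZ : l.drop (3 * s + 1) ≠ [] := by rw [← List.length_pos_iff_ne_nil]; simp; omega
  have hcyc' := hcyc.drop_vertex hA hB (by simp [hX])
    (by
      rw [List.getLast?_append_of_ne_nil _ hX, List.getLast?_take_succ (by omega),
        List.getLast?_take_drop (by omega) (by omega)]
      simpa using e0)
    (by
      rw [List.head?_append_of_ne_nil _ hZ, List.getLast?_take_drop (by omega) (by omega),
        List.head?_drop, List.getElem?_eq_getElem (by omega)]
      simpa using e1)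
    (by
      rw [List.head?_take_drop (by omega) (by omega), List.head?_take_drop (by omega) (by omega)]
      simpa using e2.symm)
  refine ⟨_, hcyc', fun x hx => hlP x ?_, ?_⟩
  · have : x ∈ A ∨ x ∈ B ∨ x ∈ l.drop (3 * s + 1) ∨ x ∈ l.take (3 * p + 1) := by
      simp only [List.mem_append, List.mem_reverse] at hx
      tauto
    rcases this with h | h | h | h
    · exact List.mem_of_mem_drop (List.mem_of_mem_take h)
    · exact List.mem_of_mem_drop (List.mem_of_mem_take h)
    · exact List.mem_of_mem_drop h
    · exact List.mem_of_mem_take h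
  · simp [A, B]
    omega

/-- A sufficiently connected set of at least `n` vertices contains a cycle of length exactly `n`,
when `n` is large in terms of the independence number. -/
theorem ConnectedWithin.cycleGraph_isContained (m : ℕ) : ∃ n₀ : ℕ, ∀ n ≥ n₀, ∀ (V : Type u)
    (G : SimpleGraph V) (P : Finset V), G.ConnectedWithin P m →
    (∀ I ⊆ P, G.IsIndepSet (I : Set V) → #I < m) → n ≤ #P → (cycleGraph n).IsContained G := by
  obtain ⟨L, hL⟩ := exists_isCyclicList_pred.{u} m
  -- `L` permits shortening all the way down to `n`, `m` gives `m ≤ #P`, and `3` excludes degenerate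
  -- cycles.
  refine ⟨L + m + 3, fun n hn V G P hP hind hnP => ?_⟩
  obtain ⟨l, hl, hlen, hlP⟩ := hP.exists_isCyclicList hind (by omega)
  have : ∀ d, ∀ l, G.IsCyclicList l → (∀ x ∈ l, x ∈ P) → l.length = n + d →
      ∃ l', G.IsCyclicList l' ∧ l'.length = n := by
    intro d
    induction d with
    | zero => exact fun l h1 _ h3 => ⟨l, h1, h3⟩
    | succ d ih =>
      intro l h1 h2 h3
      obtain ⟨l', k1, k2, k3⟩ := hL V G P hind l h1 h2 (by omega)
      exact ih l' k1 k2 (by omega)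
  obtain ⟨l', h1, h2⟩ := this (#P - n) l hl (fun x => (hlP x).1) (by omega)
  subst h2
  exact h1.cycleGraph_isContained (by omega)

end SimpleGraph

/-! ### Well-connected pieces, and long cycle versus multipartite hole. -/

namespace SimpleGraph

open Finset

universe u

variable {V : Type u}

/-- No edges between the disjoint sets `A` and `B`. -/
def Separated (G : SimpleGraph V) (A B : Finset V) : Prop :=
  ∀ a ∈ A, ∀ b ∈ B, a ≠ b ∧ ¬ G.Adj a b

theorem Separated.symm {G : SimpleGraph V} {A B : Finset V} (h : G.Separated A B) :
    G.Separated B A :=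
  fun a ha b hb => ⟨(h b hb a ha).1.symm, fun hab => (h b hb a ha).2 hab.symm⟩

theorem Separated.mono {G : SimpleGraph V} {A B A' B' : Finset V} (h : G.Separated A B)
    (hA : A' ⊆ A) (hB : B' ⊆ B) : G.Separated A' B' :=
  fun a ha b hb => h a (hA ha) b (hB hb)

/-- Every nonempty set decomposes into pairwise separated, well-connected parts and a small rest. -/
theorem exists_separated_connectedWithin (G : SimpleGraph V) (m : ℕ) (U : Finset V)
    (hU : U.Nonempty) : ∃ F : Finset (Finset V),
      (∀ A ∈ F, A ⊆ U ∧ A.Nonempty ∧ G.ConnectedWithin A m) ∧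
      (∀ A ∈ F, ∀ B ∈ F, A ≠ B → G.Separated A B) ∧
      #U + m ≤ ∑ A ∈ F, #A + m * #F := by
  classical
  induction h : #U using Nat.strong_induction_on generalizing U with
  | _ N ih =>
    subst h
    by_cases hc : G.ConnectedWithin U m
    · refine ⟨{U}, ?_, ?_, by simp⟩
      · simpa using ⟨hU, hc⟩
      · intro A hA B hB hAB
        rw [mem_singleton] at hA hB
        exact absurd (hA.trans hB.symm) hAB
    simp only [ConnectedWithin, not_forall, not_or, not_le] at hc
    obtain ⟨H, hHU, hH, hlt, hne⟩ := hc
    set N := G.boundaryIn U H with hN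
    have hNU : N ⊆ U := fun x hx => (mem_boundaryIn.1 hx).1.1
    have hHN : Disjoint H N := by
      rw [Finset.disjoint_right]
      exact fun x hx => (mem_boundaryIn.1 hx).1.2
    have hss : H ∪ N ⊂ U := (union_subset hHU hNU).ssubset_of_ne hne
    have hB : (U \ (H ∪ N)).Nonempty := sdiff_nonempty.2 hss.2
    have hcard := card_sdiff_add_card_eq_card hss.1
    rw [card_union_of_disjoint hHN] at hcard
    have hH0 := hH.card_pos
    have hB0 := hB.card_pos
    obtain ⟨F₁, a1, b1, c1⟩ := ih #H (by omega) H hH rfl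
    obtain ⟨F₂, a2, b2, c2⟩ := ih _ (by omega) (U \ (H ∪ N)) hB rfl
    have hsep : G.Separated H (U \ (H ∪ N)) := by
      intro a ha b hb
      rw [mem_sdiff, mem_union, not_or] at hb
      refine ⟨fun hab => hb.2.1 (hab ▸ ha), fun hab => hb.2.2 ?_⟩
      exact mem_boundaryIn.2 ⟨⟨hb.1, hb.2.1⟩, a, ha, hab⟩
    have hdisj : Disjoint F₁ F₂ := by
      rw [Finset.disjoint_left]
      intro A h1 h2
      obtain ⟨x, hx⟩ := (a1 A h1).2.1
      exact (hsep x ((a1 A h1).1 hx) x ((a2 A h2).1 hx)).1 rfl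
    refine ⟨F₁ ∪ F₂, ?_, ?_, ?_⟩
    · intro A hA
      rcases mem_union.1 hA with hA | hA
      · exact ⟨(a1 A hA).1.trans hHU, (a1 A hA).2⟩
      · exact ⟨(a2 A hA).1.trans sdiff_subset, (a2 A hA).2⟩
    · intro A hA B hB hAB
      rcases mem_union.1 hA with hA | hA <;> rcases mem_union.1 hB with hB | hB
      · exact b1 A hA B hB hAB
      · exact hsep.mono (a1 A hA).1 (a2 B hB).1
      · exact (hsep.mono (a1 B hB).1 (a2 A hA).1).symm
      · exact b2 A hA B hB hAB
    -- The two inductive bounds carry `2 * m` on the left; one `m` pays for the fewer than `m`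
    -- vertices of `N` lost in the cut.
    · rw [sum_union hdisj, card_union_of_disjoint hdisj, mul_add]
      omega

/-- The complement of `G` contains the complete multipartite graph with one part of size `1`
and `k` parts of size `t`. -/
def HasMultipartiteHole (G : SimpleGraph V) (k t : ℕ) : Prop :=
  ∃ (v : V) (A : Fin k → Finset V), (∀ i, t ≤ #(A i)) ∧ (∀ i, G.Separated {v} (A i)) ∧
    ∀ i j, i ≠ j → G.Separated (A i) (A j)

/-- Any `k * t + 1` independent vertices can be split into a single vertex and `k` sets of size `t`,
which form a hole. -/
theorem card_le_of_isIndepSet {G : SimpleGraph V} {k t : ℕ} (hG : ¬ G.HasMultipartiteHole k t)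
    {I : Finset V} (hI : G.IsIndepSet (I : Set V)) : #I < k * t + 1 := by
  classical
  by_contra! hcon
  obtain ⟨v, hv⟩ : I.Nonempty := card_pos.1 (by omega)
  have hcard : Fintype.card (Fin k × Fin t) ≤ Fintype.card (I.erase v) := by
    simp [card_erase_of_mem hv]
    omega
  obtain ⟨e⟩ := Function.Embedding.nonempty_of_card_le hcard
  have hsep : ∀ a ∈ I, ∀ b ∈ I, a ≠ b → a ≠ b ∧ ¬ G.Adj a b :=
    fun a ha b hb hab => ⟨hab, hI ha hb hab⟩
  have hmem : ∀ x, (e x : V) ∈ I := fun x => mem_of_mem_erase (e x).2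
  refine hG ⟨v, fun i => univ.image fun j => (e (i, j) : V), fun i => ?_, fun i => ?_,
    fun i j hij => ?_⟩
  · rw [card_image_of_injective]
    · simp
    · intro x y hxy
      have := e.injective (Subtype.ext hxy)
      exact (Prod.mk.inj this).2
  · intro a ha b hb
    obtain ⟨j, -, rfl⟩ := mem_image.1 hb
    rw [mem_singleton] at ha
    subst ha
    exact hsep _ hv _ (hmem _) (ne_of_mem_erase (e (i, j)).2).symm
  · intro a ha b hb
    obtain ⟨x, -, rfl⟩ := mem_image.1 ha
    obtain ⟨y, -, rfl⟩ := mem_image.1 hb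
    refine hsep _ (hmem _) _ (hmem _) fun h => hij ?_
    exact (Prod.mk.inj (e.injective (Subtype.ext h))).1

/-- One representative from each set gives an independent set. -/
theorem card_lt_of_separated {G : SimpleGraph V} {m : ℕ}
    (hind : ∀ I : Finset V, G.IsIndepSet (I : Set V) → #I < m) {F : Finset (Finset V)}
    (hne : ∀ A ∈ F, A.Nonempty) (hsep : ∀ A ∈ F, ∀ B ∈ F, A ≠ B → G.Separated A B) : #F < m := by
  classical
  rcases F.eq_empty_or_nonempty with rfl | ⟨A₀, hA₀⟩
  · simpa using hind ∅ (by simp)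
  have : Nonempty V := (hne A₀ hA₀).to_type
  choose! f hf using hne
  have hinj : Set.InjOn f F := by
    intro A hA B hB hAB
    by_contra hne
    exact (hsep A hA B hB hne _ (hf A hA) _ (hf B hB)).1 hAB
  rw [← card_image_of_injOn hinj]
  refine hind _ fun x hx y hy hxy => ?_
  obtain ⟨A, hA, rfl⟩ := mem_image.1 (mem_coe.1 hx)
  obtain ⟨B, hB, rfl⟩ := mem_image.1 (mem_coe.1 hy)
  exact (hsep A hA B hB (fun h => hxy (by rw [h])) _ (hf A hA) _ (hf B hB)).2

/-- Among `k + 1` such sets, `k` of them together with one point of the remaining one form a hole.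
-/
theorem card_le_of_separated {G : SimpleGraph V} {k t : ℕ} (hG : ¬ G.HasMultipartiteHole k t)
    {F : Finset (Finset V)} (hne : ∀ A ∈ F, A.Nonempty ∧ t ≤ #A)
    (hsep : ∀ A ∈ F, ∀ B ∈ F, A ≠ B → G.Separated A B) : #F ≤ k := by
  by_contra! hcon
  have hcard : Fintype.card (Fin (k + 1)) ≤ Fintype.card F := by simpa using hcon
  obtain ⟨e⟩ := Function.Embedding.nonempty_of_card_le hcard
  have hs : ∀ i j, i ≠ j → G.Separated (e i) (e j) := fun i j hij =>
    hsep _ (e i).2 _ (e j).2 fun h => hij (e.injective (Subtype.ext h))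
  obtain ⟨v, hv⟩ := (hne _ (e (Fin.last k)).2).1
  refine hG ⟨v, fun i => e i.castSucc, fun i => (hne _ (e i.castSucc).2).2, fun i => ?_,
    fun i j hij => hs _ _ (by simpa using hij)⟩
  exact (hs _ _ (Fin.castSucc_lt_last i).ne').mono (by simpa using hv) subset_rfl

open Classical in
/-- A set in which every vertex has few non-neighbours in a large common core is well connected. -/
theorem connectedWithin_of_core {G : SimpleGraph V} {W P : Finset V} {m t : ℕ} (hPW : P ⊆ W)
    (hW : ∀ w ∈ W, #{a ∈ P | a ≠ w ∧ ¬ G.Adj w a} < t) (hP : m + 2 * t ≤ #P) :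
    G.ConnectedWithin W m := by
  intro H hHW ⟨h, hh⟩
  by_contra! hcon
  obtain ⟨hlt, hne⟩ := hcon
  have hNW : G.boundaryIn W H ⊆ W := fun x hx => (mem_boundaryIn.1 hx).1.1
  obtain ⟨w, hw⟩ := sdiff_nonempty.2 ((union_subset hHW hNW).ssubset_of_ne hne).2
  rw [mem_sdiff, mem_union, not_or] at hw
  have h1 := hW w hw.1
  have h2 := hW h (hHW hh)
  -- With `w` outside `H` and its boundary, a core vertex in `H` is a non-neighbour of `w`, and one
  -- outside `H` is a non-neighbour of `h` or a boundary vertex. Hence `#P < m + 2 * t`.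
  have hsub : P ⊆ (P.filter fun a => a ≠ w ∧ ¬ G.Adj w a) ∪
      ((P.filter fun a => a ≠ h ∧ ¬ G.Adj h a) ∪ G.boundaryIn W H) := by
    intro a ha
    simp only [mem_union, mem_filter, mem_boundaryIn]
    by_cases haH : a ∈ H
    · refine .inl ⟨ha, fun e => hw.2.1 (e ▸ haH), fun hadj => hw.2.2 ?_⟩
      exact mem_boundaryIn.2 ⟨⟨hw.1, hw.2.1⟩, a, haH, hadj.symm⟩
    · by_cases hadj : G.Adj h a
      · exact .inr (.inr ⟨⟨hPW ha, haH⟩, h, hh, hadj⟩)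
      · exact .inr (.inl ⟨ha, fun e => haH (e ▸ hh), hadj⟩)
  have h3 := (card_le_card hsub).trans ((card_union_le _ _).trans
    (Nat.add_le_add_left (card_union_le _ _) _))
  omega

/-- A large graph on `k * (n - 1) + 1` vertices contains a cycle of length `n`, or its complement
contains the complete multipartite graph with parts of sizes `1, t, …, t`. -/
theorem cycleGraph_isContained_or_hasMultipartiteHole (k t : ℕ) : ∃ n₀ : ℕ, ∀ n ≥ n₀,
    ∀ (V : Type u) [Fintype V] (G : SimpleGraph V), k * (n - 1) + 1 ≤ Fintype.card V →
      (cycleGraph n).IsContained G ∨ G.HasMultipartiteHole k t := by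
  classical
  set m := k * t + 1 with hm
  obtain ⟨n₀, hn₀⟩ := ConnectedWithin.cycleGraph_isContained.{u} m
  -- `c` bounds the vertices outside the large pieces: fewer than `m` small pieces of fewer than `t`
  -- vertices each, and at most `m` vertices lost per piece.
  set c := m * t + m * m with hc
  refine ⟨n₀ + m + c + 2 * t + 2, fun n hn V _ G hV => ?_⟩
  by_contra! hcon
  obtain ⟨hcyc, hG⟩ := hcon
  have hind : ∀ I : Finset V, G.IsIndepSet (I : Set V) → #I < m :=
    fun I hI => card_le_of_isIndepSet hG hI
  have hsmall : ∀ P : Finset V, G.ConnectedWithin P m → #P ≤ n - 1 := by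
    intro P hP
    by_contra! h
    exact hcyc.false (hn₀ n (by omega) V G P hP (fun I _ hI => hind I hI) (by omega)).some
  obtain ⟨F, hF, hsep, hcount⟩ := exists_separated_connectedWithin G m univ
    (card_pos.1 (by rw [card_univ]; omega))
  have hFm : #F < m := card_lt_of_separated hind (fun A hA => (hF A hA).2.1) hsep
  set F' := F.filter fun A => t ≤ #A with hF'
  have hF'F : F' ⊆ F := filter_subset _ _
  have hF't : ∀ A ∈ F', t ≤ #A := fun A hA => (mem_filter.1 hA).2
  have hF'k : #F' ≤ k := card_le_of_separated hG
    (fun A hA => ⟨(hF A (hF'F hA)).2.1, hF't A hA⟩)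
    (fun A hA B hB => hsep A (hF'F hA) B (hF'F hB))
  have hcount' : Fintype.card V ≤ ∑ A ∈ F', #A + c := by
    have h1 : ∑ A ∈ F', #A + ∑ A ∈ F with ¬ t ≤ #A, #A = ∑ A ∈ F, #A :=
      sum_filter_add_sum_filter_not F (fun A => t ≤ #A) (fun A => #A)
    have h2 : ∑ A ∈ F with ¬ t ≤ #A, #A ≤ m * t := by
      refine (sum_le_card_nsmul _ _ t fun A hA => ?_).trans ?_
      · have := (mem_filter.1 hA).2
        omega
      · rw [smul_eq_mul]
        exact Nat.mul_le_mul_right _ ((card_filter_le _ _).trans hFm.le)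
    have h3 : m * #F ≤ m * m := Nat.mul_le_mul_left _ hFm.le
    rw [card_univ] at hcount
    omega
  have hlarge : ∀ A ∈ F', k * (n - 1) + 1 ≤ #A + (#F' - 1) * (n - 1) + c := by
    intro A hA
    have h1 : ∑ B ∈ F'.erase A, #B ≤ (#F' - 1) * (n - 1) := by
      refine (sum_le_card_nsmul _ _ (n - 1) fun B hB => ?_).trans ?_
      · exact hsmall B (hF B (hF'F (mem_of_mem_erase hB))).2.2
      · rw [smul_eq_mul, card_erase_of_mem hA]
    have h2 := add_sum_erase F' (fun A => #A) hA
    omega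
  -- With fewer than `k` large pieces, at most `(k - 1) * (n - 1) + c` vertices would be accounted
  -- for.
  have hk : #F' = k := by
    refine le_antisymm hF'k ?_
    by_contra! hlt
    have h1 : ∑ A ∈ F', #A ≤ #F' * (n - 1) := by
      refine (sum_le_card_nsmul _ _ (n - 1) fun B hB => ?_).trans ?_
      · exact hsmall B (hF B (hF'F hB)).2.2
      · rw [smul_eq_mul]
    have h2 : (#F' + 1) * (n - 1) ≤ k * (n - 1) := Nat.mul_le_mul_right _ hlt
    rw [add_mul] at h2
    omega
  have hlarge' : ∀ A ∈ F', m + 2 * t ≤ #A := by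
    intro A hA
    have h1 := hlarge A hA
    have h2 : 0 < #F' := card_pos.2 ⟨A, hA⟩
    rw [hk] at h1 h2
    have h3 : k * (n - 1) = (k - 1) * (n - 1) + (n - 1) := by
      rw [← Nat.succ_mul, Nat.succ_eq_add_one, Nat.sub_add_cancel h2]
    omega
  have e : Fin k ≃ F' := (F'.equivFinOfCardEq hk).symm
  have hPsep : ∀ i j, i ≠ j → G.Separated (e i) (e j) := fun i j hij =>
    hsep _ (hF'F (e i).2) _ (hF'F (e j).2) fun h => hij (e.injective (Subtype.ext h))
  -- A vertex with `t` non-neighbours in every large piece would form a hole with them.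
  have hcls : ∀ v, ∃ i, #{a ∈ (e i : Finset V) | a ≠ v ∧ ¬ G.Adj v a} < t := by
    intro v
    by_contra! hcon
    refine hG ⟨v, _, hcon, fun i => ?_, fun i j hij =>
      (hPsep i j hij).mono (filter_subset _ _) (filter_subset _ _)⟩
    intro a ha b hb
    rw [mem_singleton] at ha
    subst ha
    exact ⟨(mem_filter.1 hb).2.1.symm, (mem_filter.1 hb).2.2⟩
  choose cls hcls using hcls
  -- Each piece lies in its own class, since its vertices miss all of every other large piece. It
  -- therefore serves as the core of that class.
  have hPcls : ∀ j, ∀ v ∈ (e j : Finset V), cls v = j := by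
    intro j v hv
    by_contra hne
    have h1 := hcls v
    rw [filter_true_of_mem] at h1
    · exact absurd (hF't _ (e (cls v)).2) (by omega)
    · intro a ha
      exact hPsep j (cls v) (Ne.symm hne) v hv a ha |>.imp_left Ne.symm
  obtain ⟨i, -, hi⟩ := exists_lt_card_fiber_of_mul_lt_card_of_maps_to (s := (univ : Finset V))
    (t := (univ : Finset (Fin k))) (f := cls) (n := n - 1) (fun _ _ => mem_univ _) (by
      simp only [card_univ, Fintype.card_fin]; omega)
  have hconn : G.ConnectedWithin ({v | cls v = i} : Finset V) m := by
    refine connectedWithin_of_core (P := e i) (t := t) (fun v hv => by simpa using hPcls i v hv)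
      (fun w hw => ?_) (hlarge' _ (e i).2)
    have := hcls w
    rwa [(mem_filter.1 hw).2] at this
  have := hsmall _ hconn
  omega

end SimpleGraph

/-! ### Odd cycles and their blow-ups. -/

namespace SimpleGraph

open Finset

universe u

/-- `f` traverses a closed walk of length `q`, periodically. -/
def IsClosedSeq {W : Type*} (Γ : SimpleGraph W) (f : ℕ → W) (q : ℕ) : Prop :=
  (∀ i, Γ.Adj (f i) (f (i + 1))) ∧ ∀ i, f (i + q) = f i

theorem isClosedSeq_mod {W : Type*} {Γ : SimpleGraph W} {g : ℕ → W} {d : ℕ} (hd : 0 < d)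
    (h : ∀ i < d, Γ.Adj (g i) (g (i + 1))) (h0 : g d = g 0) :
    Γ.IsClosedSeq (fun i => g (i % d)) d := by
  refine ⟨fun i => ?_, fun i => by simp⟩
  have hlt := Nat.mod_lt i hd
  have := h _ hlt
  rcases Nat.lt_or_ge (i % d + 1) d with h' | h'
  · simp only [Nat.add_mod i 1 d]
    rw [Nat.add_mod, Nat.mod_mod, Nat.mod_mod, ← Nat.add_mod, Nat.add_mod_eq_add_mod_right 1
      (Nat.mod_mod i d).symm, Nat.mod_eq_of_lt h']
    exact this
  · have e : i % d + 1 = d := by omega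
    have e' : (i + 1) % d = 0 := by
      rw [Nat.add_mod_eq_add_mod_right 1 (Nat.mod_mod i d).symm, e, Nat.mod_self]
    simp only [e']
    rw [e, h0] at this
    exact this

/-- A graph that is not bipartite has an odd cycle. -/
theorem exists_odd_isClosedSeq {W : Type*} {Γ : SimpleGraph W} (h : ¬ Γ.Colorable 2) :
    ∃ (q : ℕ) (f : ℕ → W), Odd q ∧ Γ.IsClosedSeq f q ∧ ∀ i j, f i = f j → i % q = j % q := by
  classical
  have hex : ∃ q, Odd q ∧ ∃ f, Γ.IsClosedSeq f q := by
    rw [two_colorable_iff_forall_loop_even] at h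
    push Not at h
    obtain ⟨u, w, hw⟩ := h
    rw [Nat.not_even_iff_odd] at hw
    refine ⟨w.length, hw, _, isClosedSeq_mod (g := w.getVert) hw.pos
      (fun i hi => w.adj_getVert_succ hi) (by simp)⟩
  obtain ⟨hq, f, hf⟩ := Nat.find_spec hex
  have hmin := fun m => Nat.find_min (m := m) hex
  set q := Nat.find hex
  refine ⟨q, f, hq, hf, ?_⟩
  have hper : ∀ i, f i = f (i % q) := by
    have : ∀ k i, f (i + q * k) = f i := by
      intro k
      induction k with
      | zero => simp
      | succ k ih => intro i; rw [Nat.mul_succ, ← Nat.add_assoc, hf.2, ih]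
    intro i
    conv_lhs => rw [← Nat.mod_add_div i q]
    exact this _ _
  -- A repeated vertex splits the closed walk into two shorter ones, one of them odd, against the
  -- minimality of `q`.
  have hlt : ∀ i j, i < j → j < q → f i ≠ f j := by
    intro i j hij hj heq
    have h1 : Γ.IsClosedSeq (fun k => f (i + k % (j - i))) (j - i) :=
      isClosedSeq_mod (g := fun k => f (i + k)) (by omega) (fun k _ => hf.1 _)
        (by simp only [Nat.add_zero, Nat.add_sub_cancel' hij.le, heq])
    have h2 : Γ.IsClosedSeq (fun k => f (j + k % (q - (j - i)))) (q - (j - i)) :=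
      isClosedSeq_mod (g := fun k => f (j + k)) (by omega) (fun k _ => hf.1 _) (by
        simp only [Nat.add_zero]
        rw [show j + (q - (j - i)) = i + q by omega, hf.2, heq])
    rcases Nat.even_or_odd (j - i) with he | ho
    · exact hmin _ (by omega) ⟨Nat.Odd.sub_even (by omega) hq he, _, h2⟩
    · exact hmin _ (by omega) ⟨ho, _, h1⟩
  intro i j hij
  rw [hper i, hper j] at hij
  have hi := Nat.mod_lt i hq.pos
  have hj := Nat.mod_lt j hq.pos
  rcases lt_trichotomy (i % q) (j % q) with h | h | h
  · exact absurd hij (hlt _ _ h hj)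
  · exact h
  · exact absurd hij.symm (hlt _ _ h hi)

/-- Blowing up an odd cycle, where one vertex need not be blown up, gives all longer odd cycles. -/
theorem cycleGraph_isContained_of_blowup {V W : Type*} {G : SimpleGraph V} {Γ : SimpleGraph W}
    {B : W → Finset V} {z : W} {ℓ q : ℕ} {f : ℕ → W} (hℓ : Odd ℓ) (hq : Odd q) (hqℓ : q ≤ ℓ)
    (hf : Γ.IsClosedSeq f q) (hinj : ∀ i j, f i = f j → i % q = j % q)
    (hz : (B z).Nonempty) (hB : ∀ x ≠ z, ℓ ≤ #(B x))
    (hdisj : ∀ x y, x ≠ y → Disjoint (B x) (B y))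
    (hadj : ∀ x y, Γ.Adj x y → ∀ a ∈ B x, ∀ b ∈ B y, G.Adj a b) :
    (cycleGraph ℓ).IsContained G := by
  -- The cycle is rotated so that `z`, if visited at all, is at index `0`.
  wlog hfz : ∀ k, 0 < k → k < q → f k ≠ z generalizing f
  · push Not at hfz
    obtain ⟨i, -, -, hi⟩ := hfz
    refine this (f := fun k => f (i + k)) ⟨fun k => hf.1 _, fun k => ?_⟩ (fun j k hjk => ?_)
      fun k hk0 hkq hk => ?_
    · have := hf.2 (i + k)
      rwa [Nat.add_assoc] at this
    · exact Nat.ModEq.add_left_cancel' i (hinj _ _ hjk)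
    · have : i + k ≡ i + 0 [MOD q] := hinj _ _ (hk.trans hi.symm)
      have := Nat.ModEq.add_left_cancel' i this
      rw [Nat.ModEq, Nat.mod_eq_of_lt hkq, Nat.zero_mod] at this
      omega
  have hq3 : 3 ≤ q := by
    rcases hq with ⟨a, rfl⟩
    rcases a with _ | a
    · have h1 := hf.1 0
      have h2 := hf.2 0
      simp only [Nat.mul_zero, Nat.zero_add] at h1 h2
      rw [h2] at h1
      exact absurd h1 (Γ.loopless.irrefl _)
    · omega
  -- Representatives are indexed by positions on the long cycle, so repeated visits to a part use
  -- different vertices. For `z` a constant suffices, as it is visited at most once.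
  have hrep : ∀ y, ∃ ρ : Fin ℓ → V, (∀ x, ρ x ∈ B y) ∧ (y ≠ z → Function.Injective ρ) := by
    intro y
    by_cases hy : y = z
    · subst hy
      obtain ⟨v, hv⟩ := hz
      exact ⟨fun _ => v, fun _ => hv, fun h => absurd rfl h⟩
    · obtain ⟨e⟩ := Function.Embedding.nonempty_of_card_le (α := Fin ℓ) (β := B y)
        (by simpa using hB y hy)
      exact ⟨fun x => e x, fun x => (e x).2, fun _ => Subtype.val_injective.comp e.injective⟩
  choose ρ hρ hρinj using hrep
  -- Go once around, then back and forth along the edge from `f (q - 2)` to `f (q - 1)`. Since `ℓ -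
  -- q` is even, position `ℓ - 1` is at `f (q - 1)`, which is adjacent to `f 0`.
  let g : ℕ → W := fun x => if x < q then f x else if Even (x - q) then f (q - 2) else f (q - 1)
  have e1 : Γ.Adj (f (q - 2)) (f (q - 1)) := by
    have := hf.1 (q - 2)
    rwa [show q - 2 + 1 = q - 1 by omega] at this
  have e2 : Γ.Adj (f (q - 1)) (f 0) := by
    have := hf.1 (q - 1)
    have h0 := hf.2 0
    rw [Nat.zero_add] at h0
    rwa [show q - 1 + 1 = q by omega, h0] at this
  have g1 : ∀ x < q, g x = f x := fun x h => if_pos h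
  have g2 : ∀ x, q ≤ x → Even (x - q) → g x = f (q - 2) := fun x h he => by
    simp only [g]
    rw [if_neg (by omega), if_pos he]
  have g3 : ∀ x, q ≤ x → Odd (x - q) → g x = f (q - 1) := fun x h ho => by
    simp only [g]
    rw [if_neg (by omega), if_neg (Nat.not_even_iff_odd.2 ho)]
  have hg : ∀ x, Γ.Adj (g x) (g (x + 1)) := by
    intro x
    rcases lt_trichotomy (x + 1) q with h | h | h
    · rw [g1 x (by omega), g1 _ h]; exact hf.1 x
    · rw [g1 x (by omega), g2 _ h.ge (by simp [h]), show x = q - 1 by omega]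
      exact e1.symm
    · have hs : x + 1 - q = x - q + 1 := by omega
      rcases Nat.even_or_odd (x - q) with he | ho
      · rw [g2 x (by omega) he, g3 _ h.le (by rw [hs]; exact he.add_one)]; exact e1
      · rw [g3 x (by omega) ho, g2 _ h.le (by rw [hs]; exact ho.add_one)]; exact e1.symm
  have hg0 : Γ.Adj (g (ℓ - 1)) (g 0) := by
    have : g (ℓ - 1) = f (q - 1) := by
      rcases hqℓ.eq_or_lt with rfl | h
      · exact g1 _ (by omega)
      · refine g3 _ (by omega) ?_
        rw [show ℓ - 1 - q = ℓ - q - 1 by omega]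
        exact Nat.Even.sub_odd (by omega) (Nat.Odd.sub_odd hℓ hq) odd_one
    rw [this, g1 0 hq.pos]
    exact e2
  have hgz : ∀ x, g x = z → x = 0 := by
    intro x hx
    by_contra hne
    simp only [g] at hx
    split_ifs at hx with h1 h2
    · exact hfz x (by omega) h1 hx
    · exact hfz _ (by omega) (by omega) hx
    · exact hfz _ (by omega) (by omega) hx
  refine ⟨⟨⟨fun x => ρ (g x) x, ?_⟩, ?_⟩⟩
  · intro u v huv
    refine hadj _ _ ?_ _ (hρ _ _) _ (hρ _ _)
    rcases val_cases_of_cycleGraph_adj huv with h | h | ⟨h, h'⟩ | ⟨h, h'⟩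
    · rw [← h]; exact hg _
    · rw [← h]; exact (hg _).symm
    · rw [h, show v.val = ℓ - 1 by omega]; exact hg0.symm
    · rw [h, show u.val = ℓ - 1 by omega]; exact hg0
  · intro u v huv
    change ρ (g u) u = ρ (g v) v at huv
    by_cases hne : g u = g v
    · by_cases hz' : g u = z
      · exact Fin.ext ((hgz _ hz').trans (hgz _ (hne ▸ hz')).symm)
      · rw [← hne] at huv
        exact hρinj _ hz' huv
    · have := Finset.disjoint_left.1 (hdisj _ _ hne) (hρ (g u) u)
      exact absurd (huv ▸ hρ (g v) v) this

/-- If `r` graphs cover all pairs of more than `2 ^ r` vertices, then for some `s` the graph of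
index `s` has an odd cycle on a set of at most `2 ^ (s + 1) + 1` of these. -/
theorem exists_not_colorable_two {W : Type*} (r : ℕ) (Γ : Fin r → SimpleGraph W) (S : Finset W)
    (hS : 2 ^ r < #S) (hcov : ∀ x ∈ S, ∀ y ∈ S, x ≠ y → ∃ s, (Γ s).Adj x y) :
    ∃ s : Fin r, ∃ T : Finset W, #T ≤ 2 ^ ((s : ℕ) + 1) + 1 ∧
      ¬ ((Γ s).induce (T : Set W)).Colorable 2 := by
  classical
  induction r generalizing S with
  | zero =>
    obtain ⟨x, hx, y, hy, hxy⟩ := one_lt_card.1 (by simpa using hS)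
    exact (hcov x hx y hy hxy).choose.elim0
  | succ r ih =>
    obtain ⟨T, hTS, hT⟩ := exists_subset_card_eq (Nat.succ_le_of_lt hS)
    -- If the last graph is bipartite on these `2 ^ (r + 1) + 1` vertices, one side has more than `2
    -- ^ r` of them and is covered by the other graphs.
    by_cases hc : ((Γ (Fin.last r)).induce (T : Set W)).Colorable 2
    swap
    · exact ⟨Fin.last r, T, by simpa using hT.le, hc⟩
    obtain ⟨C⟩ := hc
    obtain ⟨b, -, hb⟩ := exists_lt_card_fiber_of_mul_lt_card_of_maps_to (s := T.attach)
      (t := (univ : Finset (Fin 2))) (f := fun x => C ⟨x.1, x.2⟩) (n := 2 ^ r)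
      (fun _ _ => mem_univ _) (by simp [hT, pow_succ]; omega)
    obtain ⟨s, U, hU, hcU⟩ := ih (fun s => Γ s.castSucc)
      ((T.attach.filter fun x => C ⟨x.1, x.2⟩ = b).image Subtype.val)
      (by rwa [card_image_of_injective _ Subtype.val_injective]) (by
        intro x hx y hy hxy
        obtain ⟨⟨x, hxT⟩, hxC, rfl⟩ := mem_image.1 hx
        obtain ⟨⟨y, hyT⟩, hyC, rfl⟩ := mem_image.1 hy
        replace hxC : C ⟨x, hxT⟩ = b := (mem_filter.1 hxC).2
        replace hyC : C ⟨y, hyT⟩ = b := (mem_filter.1 hyC).2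
        obtain ⟨s, hs⟩ := hcov x (hTS hxT) y (hTS hyT) hxy
        induction s using Fin.lastCases with
        | cast s => exact ⟨s, hs⟩
        | last =>
          have := C.valid (v := ⟨x, hxT⟩) (w := ⟨y, hyT⟩) hs
          exact absurd (hxC.trans hyC.symm) this)
    exact ⟨s.castSucc, U, by simpa using hU, hcU⟩

/-! ### From a multipartite hole to a monochromatic odd cycle. -/

/-- A large complete bipartite graph with coloured edges contains a monochromatic one. -/
theorem exists_monochromatic_bipartite {K : Type*} [Fintype K] (t : ℕ) : ∃ T : ℕ,
    ∀ (V : Type u) (c : V → V → K) (A B : Finset V), T ≤ #A → T ≤ #B →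
      ∃ A' ⊆ A, ∃ B' ⊆ B, t ≤ #A' ∧ t ≤ #B' ∧ ∃ s, ∀ a ∈ A', ∀ b ∈ B', c a b = s := by
  classical
  set M := Fintype.card K * t + 1 with hM
  refine ⟨M + Fintype.card K ^ M * t, fun V c A B hA hB => ?_⟩
  obtain ⟨A₀, hA₀, hc₀⟩ := exists_subset_card_eq (show M ≤ #A by omega)
  rcases B.eq_empty_or_nonempty with rfl | ⟨b₀, hb₀⟩
  · simp at hB
  obtain ⟨a₀, ha₀⟩ : A₀.Nonempty := card_pos.1 (by omega)
  have : Nonempty K := ⟨c a₀ b₀⟩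
  -- Each `b` determines its colour pattern on `A₀`. Many `b` share a pattern `φ`, and `φ` takes one
  -- colour on many vertices of `A₀`.
  obtain ⟨φ, -, hφ⟩ := exists_le_card_fiber_of_mul_le_card_of_maps_to (s := B)
    (t := (univ : Finset (A₀ → K))) (f := fun b a => c a b) (n := t) (fun _ _ => mem_univ _)
    univ_nonempty (by simp [hc₀]; omega)
  obtain ⟨s, -, hs⟩ := exists_le_card_fiber_of_mul_le_card_of_maps_to (s := A₀.attach)
    (t := (univ : Finset K)) (f := φ) (n := t) (fun _ _ => mem_univ _) univ_nonempty
    (by simp [hc₀]; omega)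
  refine ⟨(A₀.attach.filter fun x => φ x = s).image Subtype.val, ?_, _, filter_subset _ _, ?_, hφ,
    s, ?_⟩
  · intro x hx
    obtain ⟨y, -, rfl⟩ := mem_image.1 hx
    exact hA₀ y.2
  · rwa [card_image_of_injective _ Subtype.val_injective]
  · intro a ha b hb
    obtain ⟨y, hy, rfl⟩ := mem_image.1 ha
    rw [← (mem_filter.1 hy).2, ← (mem_filter.1 hb).2]

/-- The pairs are treated one at a time: shrinking parts for a new pair preserves monochromaticity
of the earlier ones, provided these were left with at least `max t T₁` vertices. -/
theorem exists_monochromatic_multipartite {K ι : Type*} [Fintype K] (E : Finset (ι × ι)) (t : ℕ) :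
    ∃ T : ℕ, ∀ (V : Type u) (c : V → V → K) (A : ι → Finset V), (∀ i, T ≤ #(A i)) →
      ∃ A' : ι → Finset V, (∀ i, A' i ⊆ A i ∧ t ≤ #(A' i)) ∧
        ∀ e ∈ E, e.1 ≠ e.2 → ∃ s, ∀ a ∈ A' e.1, ∀ b ∈ A' e.2, c a b = s := by
  classical
  induction E using Finset.induction_on generalizing t with
  | empty => exact ⟨t, fun V c A hA => ⟨A, fun i => ⟨subset_rfl, hA i⟩, by simp⟩⟩
  | insert e E he ih =>
    obtain ⟨T₁, h₁⟩ := exists_monochromatic_bipartite.{u} (K := K) t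
    obtain ⟨T₂, h₂⟩ := ih (max t T₁)
    refine ⟨T₂, fun V c A hA => ?_⟩
    obtain ⟨A₁, hA₁, hE⟩ := h₂ V c A hA
    obtain ⟨X, hX, Y, hY, hXt, hYt, s, hs⟩ := h₁ V c (A₁ e.1) (A₁ e.2)
      ((le_max_right _ _).trans (hA₁ _).2) ((le_max_right _ _).trans (hA₁ _).2)
    by_cases hne : e.1 = e.2
    · refine ⟨A₁, fun i => ⟨(hA₁ i).1, (le_max_left _ _).trans (hA₁ i).2⟩, ?_⟩
      intro e' he' hne'
      rcases mem_insert.1 he' with rfl | he'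
      · exact absurd hne hne'
      · exact hE e' he' hne'
    · let A₂ : ι → Finset V := Function.update (Function.update A₁ e.1 X) e.2 Y
      have h1 : A₂ e.1 = X := by simp [A₂, hne]
      have h2 : A₂ e.2 = Y := by simp [A₂]
      have h3 : ∀ i, i ≠ e.1 → i ≠ e.2 → A₂ i = A₁ i := fun i hi hi' => by simp [A₂, hi, hi']
      have hsub : ∀ i, A₂ i ⊆ A₁ i ∧ t ≤ #(A₂ i) := by
        intro i
        by_cases hi : i = e.1
        · subst hi; rw [h1]; exact ⟨hX, hXt⟩
        by_cases hi' : i = e.2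
        · subst hi'; rw [h2]; exact ⟨hY, hYt⟩
        · rw [h3 i hi hi']; exact ⟨subset_rfl, (le_max_left _ _).trans (hA₁ i).2⟩
      refine ⟨A₂, fun i => ⟨(hsub i).1.trans (hA₁ i).1, (hsub i).2⟩, ?_⟩
      intro e' he' hne'
      rcases mem_insert.1 he' with rfl | he'
      · exact ⟨s, by rw [h1, h2]; exact hs⟩
      · obtain ⟨s', hs'⟩ := hE e' he' hne'
        exact ⟨s', fun a ha b hb => hs' a ((hsub _).1 ha) b ((hsub _).1 hb)⟩

/-- If the complete multipartite graph with parts of sizes `1, t, …, t` (`2 ^ r` parts of size `t`)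
is covered by `r` graphs and `t` is large, then one of these graphs contains its odd cycle. -/
theorem HasMultipartiteHole.exists_cycleGraph_isContained (r : ℕ) (ℓ : Fin r → ℕ)
    (hodd : ∀ s, Odd (ℓ s)) (hlarge : ∀ s : Fin r, 2 ^ ((s : ℕ) + 1) < ℓ s) :
    ∃ t : ℕ, ∀ (V : Type u) (G : SimpleGraph V) (Γ : Fin r → SimpleGraph V),
      (∀ x y, x ≠ y → ¬ G.Adj x y → ∃ s, (Γ s).Adj x y) → G.HasMultipartiteHole (2 ^ r) t →
        ∃ s, (cycleGraph (ℓ s)).IsContained (Γ s) := by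
  classical
  obtain ⟨T, hT⟩ := exists_monochromatic_multipartite.{u} (K := Fin r)
    (univ : Finset (Fin (2 ^ r) × Fin (2 ^ r))) (∑ s, ℓ s)
  -- The factor `r` pays for making the star at `v` monochromatic towards each part; the `+ 1` makes
  -- parts nonempty.
  refine ⟨r * T + 1, fun V G Γ hcov ⟨v, A, hA, hvA, hAA⟩ => ?_⟩
  obtain ⟨a₀, ha₀⟩ : (A ⟨0, by positivity⟩).Nonempty :=
    card_pos.1 (by have := hA ⟨0, by positivity⟩; omega)
  have hv₀ := hvA _ v (by simp) a₀ ha₀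
  obtain ⟨s₀, -⟩ := hcov v a₀ hv₀.1 hv₀.2
  have : Nonempty (Fin r) := ⟨s₀⟩
  -- The choice `c` need not be symmetric; `s₀` is a dummy value for pairs that are equal or
  -- adjacent in `G`.
  have hc : ∀ x y, ∃ s, x ≠ y ∧ ¬ G.Adj x y → (Γ s).Adj x y := by
    intro x y
    by_cases h : x ≠ y ∧ ¬ G.Adj x y
    · exact (hcov x y h.1 h.2).imp fun s hs _ => hs
    · exact ⟨s₀, fun h' => absurd h' h⟩
  choose c hc using hc
  have hstar : ∀ i, ∃ s, T ≤ #{a ∈ A i | c v a = s} := by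
    intro i
    obtain ⟨s, -, hs⟩ := exists_le_card_fiber_of_mul_le_card_of_maps_to (s := A i)
      (t := (univ : Finset (Fin r))) (f := c v) (n := T) (fun _ _ => mem_univ _) univ_nonempty
      (by have := hA i; simp; omega)
    exact ⟨s, hs⟩
  choose σ hσ using hstar
  obtain ⟨A', hA', hmono⟩ := hT V c _ hσ
  have hA'A : ∀ i, A' i ⊆ A i := fun i => (hA' i).1.trans (filter_subset _ _)
  let B : Option (Fin (2 ^ r)) → Finset V := fun o => o.elim {v} A'
  have hsep : ∀ x y, x ≠ y → G.Separated (B x) (B y) := by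
    rintro (_ | i) (_ | j) hij
    · exact absurd rfl hij
    · exact (hvA j).mono subset_rfl (hA'A j)
    · exact ((hvA i).mono subset_rfl (hA'A i)).symm
    · exact (hAA i j fun h => hij (by rw [h])).mono (hA'A i) (hA'A j)
  let Red : Fin r → SimpleGraph (Option (Fin (2 ^ r))) := fun s =>
    { Adj := fun x y => x ≠ y ∧ ∀ a ∈ B x, ∀ b ∈ B y, (Γ s).Adj a b
      symm := ⟨fun x y h => ⟨h.1.symm, fun a ha b hb => (h.2 b hb a ha).symm⟩⟩
      loopless := ⟨fun x h => h.1 rfl⟩ }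
  have hcol : ∀ x y s, x ≠ y → (∀ a ∈ B x, ∀ b ∈ B y, c a b = s) → (Red s).Adj x y := by
    intro x y s hxy h
    refine ⟨hxy, fun a ha b hb => ?_⟩
    have := hc a b (hsep x y hxy a ha b hb)
    rwa [h a ha b hb] at this
  have hnone : ∀ i, (Red (σ i)).Adj none (some i) := by
    intro i
    refine hcol _ _ _ (by simp) fun a ha b hb => ?_
    obtain rfl : a = v := by simpa [B] using ha
    exact (mem_filter.1 ((hA' i).1 hb)).2
  have hRed : ∀ x ∈ (univ : Finset (Option (Fin (2 ^ r)))), ∀ y ∈ univ, x ≠ y →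
      ∃ s, (Red s).Adj x y := by
    rintro (_ | i) - (_ | j) - hij
    · exact absurd rfl hij
    · exact ⟨_, hnone j⟩
    · exact ⟨_, (hnone i).symm⟩
    · obtain ⟨s, hs⟩ := hmono (i, j) (mem_univ _) fun h => hij (by rw [show i = j from h])
      exact ⟨s, hcol _ _ _ hij hs⟩
  obtain ⟨s, U, hU, hcU⟩ := exists_not_colorable_two r Red univ (by simp) hRed
  obtain ⟨q, f, hq, hf, hinj⟩ := exists_odd_isClosedSeq hcU
  have hqU : q ≤ #U := by
    have := Fintype.card_le_of_injective (fun i : Fin q => f i) fun i j hij => by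
      have := hinj _ _ hij
      rw [Nat.mod_eq_of_lt i.2, Nat.mod_eq_of_lt j.2] at this
      exact Fin.ext this
    simpa using this
  refine ⟨s, cycleGraph_isContained_of_blowup (Γ := Red s) (B := B) (z := none) (q := q)
    (f := fun i => (f i : Option (Fin (2 ^ r)))) (hodd s) hq ?_ ⟨fun i => hf.1 i, fun i => ?_⟩
    (fun i j hij => hinj i j (Subtype.ext hij)) (by simp [B]) ?_ ?_ fun x y h => h.2⟩
  -- Here the lower bound on `ℓ s` enters: `q ≤ #U ≤ 2 ^ (s + 1) + 1 ≤ ℓ s`.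
  · have := hlarge s
    omega
  · exact congrArg Subtype.val (hf.2 i)
  · rintro (_ | i) hi
    · exact absurd rfl hi
    · exact (single_le_sum (f := ℓ) (fun _ _ => Nat.zero_le _) (mem_univ s)).trans (hA' i).2
  · intro x y hxy
    rw [Finset.disjoint_left]
    exact fun a ha hb => (hsep x y hxy a ha a hb).1 rfl

end SimpleGraph

/-! ### The extremal colouring and the conclusion. -/

open SimpleGraph

/-- The colouring by blocks of length `n - 1`: colour `0` inside the blocks, and between two blocks
the colour given by a binary digit in which their indices differ. -/
theorem not_hasRamseyProperty_of_le (r : ℕ) (ℓ : Fin r → ℕ) (hodd : ∀ s : Fin r, Odd (ℓ s))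
    (hlarge : ∀ s : Fin r, 2 ^ ((s : ℕ) + 1) < ℓ s) (n N : ℕ) (hn : 2 ≤ n)
    (hN : N ≤ 2 ^ r * (n - 1)) :
    ¬ HasRamseyProperty (fun i : Fin (r + 1) =>
      cycleGraph ((Fin.cons n ℓ : Fin (r + 1) → ℕ) i)) N := by
  classical
  let blk : Fin N → ℕ := fun x => x.val / (n - 1)
  have hblk : ∀ x, blk x < 2 ^ r := fun x =>
    Nat.div_lt_of_lt_mul (by rw [mul_comm]; exact x.2.trans_le hN)
  have hbit : ∀ x y, blk x ≠ blk y → ∃ s : Fin r, (blk x).testBit s ≠ (blk y).testBit s := by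
    intro x y hxy
    by_contra! h
    refine hxy (Nat.eq_of_testBit_eq fun i => ?_)
    rcases Nat.lt_or_ge i r with hi | hi
    · exact h ⟨i, hi⟩
    · have hle := Nat.pow_le_pow_right (n := 2) (by norm_num) hi
      rw [Nat.testBit_eq_false_of_lt ((hblk x).trans_le hle),
        Nat.testBit_eq_false_of_lt ((hblk y).trans_le hle)]
  let P : Fin N → Fin N → Fin (r + 1) → Prop := fun x y i =>
    if blk x = blk y then i = 0 else ∃ s : Fin r, i = s.succ ∧ (blk x).testBit s ≠ (blk y).testBit s
  have hPsymm : ∀ x y, P x y = P y x := by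
    intro x y
    funext i
    simp only [P, eq_comm (a := blk x), ne_comm (a := (blk x).testBit _)]
  have hP : ∀ x y, ∃ i, P x y i := by
    intro x y
    by_cases h : blk x = blk y
    · exact ⟨0, by simp [P, h]⟩
    · obtain ⟨s, hs⟩ := hbit x y h
      exact ⟨s.succ, by simp only [P, if_neg h]; exact ⟨s, rfl, hs⟩⟩
  -- `hPsymm` is an equality of predicates, so the choice operator picks the same colour for both
  -- orders of a pair.
  let col : Fin N → Fin N → Fin (r + 1) := fun x y => Classical.epsilon (P x y)
  have hcol : ∀ x y, P x y (col x y) := fun x y => Classical.epsilon_spec (hP x y)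
  intro h
  obtain ⟨i, φ, hinj, hφ⟩ : ∃ (i : Fin (r + 1))
      (φ : Fin ((Fin.cons n ℓ : Fin (r + 1) → ℕ) i) → Fin N), Function.Injective φ ∧
        ∀ u v, (cycleGraph _).Adj u v → col (φ u) (φ v) = i := by
    obtain ⟨i, ⟨φ⟩⟩ := h (EdgeLabeling.mk (fun x y _ => col x y) fun x y _ => by
      simp only [col, hPsymm y x])
    refine ⟨i, φ, φ.injective, fun u v huv => ?_⟩
    have := φ.toHom.map_adj huv
    rw [TopEdgeLabeling.labelGraph_adj] at this
    exact this.2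
  revert φ
  induction i using Fin.cases with
  | zero =>
    intro (φ : Fin n → Fin N) hinj
      (hφ : ∀ u v : Fin n, (cycleGraph n).Adj u v → col (φ u) (φ v) = 0)
    have hconst : ∀ u v : Fin n, blk (φ u) = blk (φ v) := by
      intro u v
      obtain ⟨w⟩ := cycleGraph_preconnected (n := n) u v
      induction w with
      | nil => rfl
      | @cons a b _ hab _ ih =>
        refine Eq.trans ?_ ih
        by_contra hne
        have := hcol (φ a) (φ b)
        rw [hφ _ _ hab] at this
        simp only [P, if_neg hne] at this
        obtain ⟨s, hs, -⟩ := this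
        exact absurd hs (Fin.succ_ne_zero s).symm
    -- The `n` vertices of the cycle lie in one block, so they have distinct residues modulo `n -
    -- 1`.
    have hcard := Fintype.card_le_of_injective
      (fun u : Fin n => (⟨(φ u).val % (n - 1), Nat.mod_lt _ (by omega)⟩ : Fin (n - 1)))
      (by
        intro u v huv
        refine hinj (Fin.ext ?_)
        have h1 : (φ u).val % (n - 1) = (φ v).val % (n - 1) := congrArg Fin.val huv
        have h2 : (φ u).val / (n - 1) = (φ v).val / (n - 1) := hconst u v
        rw [← Nat.div_add_mod (φ u).val (n - 1), ← Nat.div_add_mod (φ v).val (n - 1), h1, h2])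
    simp only [Fintype.card_fin] at hcard
    omega
  | succ s =>
    intro (φ : Fin (ℓ s) → Fin N) _
      (hφ : ∀ u v : Fin (ℓ s), (cycleGraph (ℓ s)).Adj u v → col (φ u) (φ v) = s.succ)
    have h2 : 2 ≤ ℓ s := by
      have := hlarge s
      have := Nat.one_le_two_pow (n := (s : ℕ))
      rw [pow_succ] at *
      omega
    -- Edges of colour `s.succ` join blocks differing in digit `s`, so that digit properly 2-colours
    -- an odd cycle, which is impossible.
    let C : (cycleGraph (ℓ s)).Coloring Bool :=
      Coloring.mk (fun u => (blk (φ u)).testBit s) (by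
        intro u v huv
        have := hcol (φ u) (φ v)
        rw [hφ u v huv] at this
        by_cases hb : blk (φ u) = blk (φ v)
        · simp only [P, if_pos hb] at this
          exact absurd this (Fin.succ_ne_zero s)
        · simp only [P, if_neg hb] at this
          obtain ⟨s', hs', hne⟩ := this
          rw [Fin.succ_inj] at hs'
          rwa [hs'])
    have h3 := chromaticNumber_cycleGraph_of_odd (ℓ s) h2 (hodd s)
    have h4 : (cycleGraph (ℓ s)).chromaticNumber ≤ 2 := by
      have := C.colorable.chromaticNumber_le
      simpa using this
    rw [h3] at h4
    exact absurd h4 (by decide)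

/-- Colour `0` is assigned the cycle on `n` vertices, colour `s` (for `1 ≤ s ≤ r`) the cycle on
`ℓ_s` vertices; since `Fin r` starts at `0`, the number `ℓ_s` is `ℓ` at the index of value `s - 1`. -/
theorem mainTheorem11 (r : ℕ) (ℓ : Fin r → ℕ)
    (hodd : ∀ s : Fin r, Odd (ℓ s))
    (hlarge : ∀ s : Fin r, 2 ^ ((s : ℕ) + 1) < ℓ s) :
    ∃ n₀ : ℕ, ∀ n : ℕ, n₀ ≤ n →
      IsRamseyNumber
        (fun i : Fin (r + 1) =>
          SimpleGraph.cycleGraph ((Fin.cons n ℓ : Fin (r + 1) → ℕ) i))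
        (2 ^ r * (n - 1) + 1) := by
  obtain ⟨t, ht⟩ := HasMultipartiteHole.exists_cycleGraph_isContained.{0} r ℓ hodd hlarge
  obtain ⟨n₀, hn₀⟩ := cycleGraph_isContained_or_hasMultipartiteHole.{0} (2 ^ r) t
  refine ⟨n₀ + 2, fun n hn => ⟨fun c => ?_, fun N hN => ?_⟩⟩
  · rcases hn₀ n (by omega) _ (c.labelGraph 0) (by simp) with h | h
    · exact ⟨0, h⟩
    · obtain ⟨s, hs⟩ := ht _ (c.labelGraph 0) (fun s => c.labelGraph s.succ) (fun x y hxy hadj => by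
        simp only [TopEdgeLabeling.labelGraph_adj] at hadj ⊢
        rcases Fin.eq_zero_or_eq_succ (c.get x y hxy) with h0 | ⟨s, hs⟩
        · exact absurd ⟨hxy, h0⟩ hadj
        · exact ⟨s, hxy, hs⟩) h
      exact ⟨s.succ, hs⟩
  · by_contra! hlt
    exact not_hasRamseyProperty_of_le r ℓ hodd hlarge n N (by omega) (by omega) hN
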